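/- Let $W$, $I$, $V$ be complex vector spaces of dimensions $m+2$, $2$ and $n+1$, where $m,n\ge 0$ are integers with $m+2\le 2(n+1)$. Let $X$ be the projective space of nonzero linear maps $W\to I\otimes V$ up to scalars, with the action of $G=\mathrm{SL}(I)\times \mathrm{SL}(W)$ given by $(g,h)\cdot A=(g\otimes \mathrm{id}_V)\circ A\circ h^{-1}$. A point $A\in X$ is called semistable if some $G$-invariant homogeneous polynomial of positive degree on $\mathrm{Hom}(W,I\otimes V)$ does not vanish at $A$, and stable if moreover its orbit is closed (for the Zariski topology) in the set of semistable points of $X$ and its stabilizer in $G$ is finite. Let $\mathbb P^n=\mathbb P(V)=(V^*\setminus\{0\})/\mathbb C^*$ and let $f_A: I^*\otimes\mathcal O_{\mathbb P^n}\to W^*\otimes\mathcal O_{\mathbb P^n}(1)$ be the morphism induced by $A$, which on the fibres at $[\xi]\in\mathbb P^n$ is, up to scalars, $\varphi\mapsto(\varphi\otimes\xi)\circ A$. Let $D(A)=\{x\in\mathbb P^n : \operatorname{rank}(f_A)_x\le 1\}$ be its degeneracy locus, and let $\operatorname{codim} D(A)=n-\dim D(A)$, where $\dim$ is the Krull dimension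 for the Zariski topology (the empty set has codimension $\infty$). If $m$ is odd and $A$ is semistable (in particular, if $A$ is stable), then $\operatorname{codim} D(A)\ge \frac{m+1}{2}$. If $m$ is even and $A$ is semistable (respectively stable), then $\operatorname{codim} D(A)\ge \frac m2$ (respectively $\operatorname{codim} D(A)>\frac m2$). -/

import Mathlib

open scoped LinearAlgebra.Projectivization TensorProduct Topology

namespace Kronecker

noncomputable section

/-! ### Polynomial functions and the Zariski topology on a projective space -/

section Zariski

variable {E : Type*} [AddCommGroup E] [Module ℂ E]

/-- A polynomial function on the vector space `E` is a polynomial expression in linear forms on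
`E`; this is its value at `v`. A polynomial which is homogeneous of degree `d` gives a homogeneous
polynomial function of degree `d`, so that its vanishing at a point of `ℙ ℂ E` does not depend on
the representative of the point. -/
def polyEval (P : MvPolynomial (Module.Dual ℂ E) ℂ) (v : E) : ℂ :=
  MvPolynomial.eval (fun l : Module.Dual ℂ E => l v) P

/-- The common zero locus in `ℙ ℂ E` of a set of (homogeneous) polynomials. -/
def zeroLocus (S : Set (MvPolynomial (Module.Dual ℂ E) ℂ)) : Set (ℙ ℂ E) :=
  {x | ∀ P ∈ S, polyEval P x.rep = 0}

/-- The projective algebraic subsets of `ℙ ℂ E`. -/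
def IsAlgebraicSet (Z : Set (ℙ ℂ E)) : Prop :=
  ∃ S : Set (MvPolynomial (Module.Dual ℂ E) ℂ),
    (∀ P ∈ S, ∃ d : ℕ, P.IsHomogeneous d) ∧ Z = zeroLocus S

theorem isAlgebraicSet_empty : IsAlgebraicSet (∅ : Set (ℙ ℂ E)) := by
  refine ⟨{1}, ?_, ?_⟩
  · rintro P rfl
    exact ⟨0, MvPolynomial.isHomogeneous_one _ _⟩
  · ext x
    simp [zeroLocus, polyEval]

theorem isAlgebraicSet_sInter (A : Set (Set (ℙ ℂ E))) (hA : ∀ Z ∈ A, IsAlgebraicSet Z) :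
    IsAlgebraicSet (⋂₀ A) := by
  choose! S hS hZ using hA
  refine ⟨⋃ Z ∈ A, S Z, ?_, ?_⟩
  · intro P hP
    simp only [Set.mem_iUnion] at hP
    obtain ⟨Z, hZA, hP⟩ := hP
    exact hS Z hZA P hP
  · ext x
    simp only [Set.mem_sInter, zeroLocus, Set.mem_iUnion, Set.mem_ofPred_eq]
    constructor
    · rintro h P ⟨Z, hZA, hP⟩
      have hx := h Z hZA
      rw [hZ Z hZA] at hx
      exact hx P hP
    · intro h Z hZA
      rw [hZ Z hZA]
      exact fun P hP => h P ⟨Z, hZA, hP⟩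

theorem isAlgebraicSet_union (Z : Set (ℙ ℂ E)) (hZ : IsAlgebraicSet Z) (Y : Set (ℙ ℂ E))
    (hY : IsAlgebraicSet Y) : IsAlgebraicSet (Z ∪ Y) := by
  obtain ⟨S, hS, rfl⟩ := hZ
  obtain ⟨T, hT, rfl⟩ := hY
  refine ⟨{R | ∃ P ∈ S, ∃ Q ∈ T, R = P * Q}, ?_, ?_⟩
  · rintro R ⟨P, hP, Q, hQ, rfl⟩
    obtain ⟨a, ha⟩ := hS P hP
    obtain ⟨b, hb⟩ := hT Q hQ
    exact ⟨a + b, ha.mul hb⟩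
  · ext x
    constructor
    · rintro (h | h) R ⟨P, hP, Q, hQ, rfl⟩
      · have := h P hP
        simp only [polyEval, map_mul] at this ⊢
        rw [this, zero_mul]
      · have := h Q hQ
        simp only [polyEval, map_mul] at this ⊢
        rw [this, mul_zero]
    · intro h
      by_cases hx : x ∈ zeroLocus S
      · exact Or.inl hx
      · right
        intro Q hQ
        simp only [zeroLocus, Set.mem_ofPred_eq, not_forall] at hx
        obtain ⟨P, hP, hne⟩ := hx
        have := h (P * Q) ⟨P, hP, Q, hQ, rfl⟩
        simp only [polyEval, map_mul] at this hne ⊢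
        exact (mul_eq_zero.mp this).resolve_left hne

/-- The Zariski topology on `ℙ ℂ E`: the closed sets are the projective algebraic sets. -/
instance zariskiTopology : TopologicalSpace (ℙ ℂ E) :=
  TopologicalSpace.ofClosed {Z | IsAlgebraicSet Z} isAlgebraicSet_empty
    isAlgebraicSet_sInter isAlgebraicSet_union

/-- The dimension of a subset of `ℙ ℂ E`: its Krull dimension as a subspace for the Zariski
topology. It is `⊥` for the empty set. -/
def dimension (Y : Set (ℙ ℂ E)) : WithBot ℕ∞ := topologicalKrullDim Y

/-- The codimension of a subset of the projective space `ℙ ℂ E` (which has dimension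
`Module.finrank ℂ E - 1`): the difference of the dimensions, and `⊤` for the empty set. -/
def codimension (Y : Set (ℙ ℂ E)) : ℕ∞ :=
  WithBot.recBotCoe ⊤ (fun d : ℕ∞ => ((Module.finrank ℂ E - 1 : ℕ) : ℕ∞) - d) (dimension Y)

end Zariski

/-! ### Semistability and stability in geometric invariant theory -/

section GIT

variable {G E : Type*} [Group G] [AddCommGroup E] [Module ℂ E]

theorem rho_injective (ρ : Representation ℂ G E) (g : G) : Function.Injective (ρ g) := by
  intro v w h
  have := congrArg (ρ g⁻¹) h
  simpa [← Module.End.mul_apply, ← map_mul] using this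

/-- The action on `ℙ ℂ E` of an element of a group acting linearly on `E`. -/
def projAct (ρ : Representation ℂ G E) (g : G) : ℙ ℂ E → ℙ ℂ E :=
  Projectivization.map (ρ g) (rho_injective ρ g)

/-- The orbit of a point of `ℙ ℂ E`. -/
def projOrbit (ρ : Representation ℂ G E) (x : ℙ ℂ E) : Set (ℙ ℂ E) :=
  Set.range fun g => projAct ρ g x

/-- A point of `ℙ ℂ E` is semistable if some invariant homogeneous polynomial of positive degree
does not vanish at it. -/
def IsSemistable (ρ : Representation ℂ G E) (x : ℙ ℂ E) : Prop :=
  ∃ (d : ℕ) (P : MvPolynomial (Module.Dual ℂ E) ℂ), 0 < d ∧ P.IsHomogeneous d ∧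
    (∀ (g : G) (v : E), polyEval P (ρ g v) = polyEval P v) ∧ polyEval P x.rep ≠ 0

/-- A point of `ℙ ℂ E` is (properly) stable if it is semistable, its orbit is closed in the set of
semistable points, and its stabilizer is finite. -/
def IsStable (ρ : Representation ℂ G E) (x : ℙ ℂ E) : Prop :=
  IsSemistable ρ x ∧
  (∀ y : ℙ ℂ E, IsSemistable ρ y → y ∈ closure (projOrbit ρ x) → y ∈ projOrbit ρ x) ∧
  {g : G | projAct ρ g x = x}.Finite

end GIT

/-! ### Kronecker modules and their degeneracy loci -/

section Degeneracy

variable {W I V : Type*} [AddCommGroup W] [Module ℂ W] [AddCommGroup I] [Module ℂ I]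
  [AddCommGroup V] [Module ℂ V]

variable (W I V) in
/-- The linear action of `SL(I) × SL(W)` on `Hom(W, I ⊗ V)`: `(g, h) • a = (g ⊗ id) ∘ a ∘ h⁻¹`. -/
def slRep : Representation ℂ (SpecialLinearGroup ℂ I × SpecialLinearGroup ℂ W)
    (W →ₗ[ℂ] I ⊗[ℂ] V) where
  toFun p :=
    { toFun := fun a => (LinearMap.rTensor V (p.1.toLinearEquiv : I →ₗ[ℂ] I)) ∘ₗ a ∘ₗ
        ((p.2⁻¹).toLinearEquiv : W →ₗ[ℂ] W)
      map_add' := fun a b => by ext; simp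
      map_smul' := fun c a => by ext; simp }
  map_one' := by
    ext a w
    simp
  map_mul' p q := by
    ext a w
    simp [LinearMap.rTensor_mul]

/-- The map induced by `a : W → I ⊗ V` on the fibres at the point `[ξ]` of `ℙ(V) = (V^* ∖ 0)/ℂ^*`
of the morphism of sheaves `I^* ⊗ 𝒪 → W^* ⊗ 𝒪(1)`: it sends `φ ∈ I^*` to the linear form
`w ↦ (φ ⊗ ξ)(a w)` on `W`. -/
def fibreMap (a : W →ₗ[ℂ] I ⊗[ℂ] V) (ξ : Module.Dual ℂ V) :
    Module.Dual ℂ I →ₗ[ℂ] Module.Dual ℂ W where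
  toFun φ := (TensorProduct.dualDistrib ℂ I V (φ ⊗ₜ[ℂ] ξ)) ∘ₗ a
  map_add' φ ψ := by
    ext w
    simp [TensorProduct.add_tmul]
  map_smul' c φ := by
    ext w
    simp [← TensorProduct.smul_tmul']

/-- The degeneracy locus `D(A)`: the set of the points `x` of `ℙ(V)` at which the morphism of
sheaves `I^* ⊗ 𝒪 → W^* ⊗ 𝒪(1)` has rank at most `1`. -/
def degeneracyLocus (A : ℙ ℂ (W →ₗ[ℂ] I ⊗[ℂ] V)) : Set (ℙ ℂ (Module.Dual ℂ V)) :=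
  {x | Module.finrank ℂ (LinearMap.range (fibreMap A.rep x.rep)) ≤ 1}

end Degeneracy

end

end Kronecker

/-! For a linear form `φ` on `I`, contraction turns `A` into a map `contract A.rep φ : W → V`; the
proof passes through the smallest rank of these maps over `φ ≠ 0`.

GIT gives a rank bound. Suppose the kernel of one contraction has at least half the dimension of
`W`. A one-parameter subgroup adapted to `ker φ` and to this kernel acts on `A` with two nonnegative
weights (`exists_oneParameter_weights`). If the kernel exceeds half, both weights are positive, `A`
flows to `0`, and every invariant of positive degree vanishes at it. If it is exactly half, `A`
flows to a semistable point fixed by the whole subgroup, which contradicts a closed orbit with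
finite stabilizer. So semistability gives rank at least `dim W / 2`, and stability makes this
strict.

The rank bound controls the dimension of `D(A)`. At the generic point `y` of an irreducible part of
`D(A)` the two rows of the fibre map are proportional: `y ∘ B₁ = t · (y ∘ B₂)`, up to exchanging
`B₁` and `B₂`. If `t` is a constant, `y` kills the range of a member of the pencil, of dimension at
least `r`. If `t` is transcendental, `y` is determined by `t` and by its values on a complement of
the range of `B₁` (`exists_generators_of_pencil`). Hence the cone has dimension at most `1 + (dim V
- r)`, and `D(A)` has codimension at least `r - 1`. -/

namespace Kronecker

/-! ### Transcendence degree and generators of function fields -/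

/-- The transcendence degree of a domain drops under a noninjective surjection onto a domain. -/
theorem trdeg_add_one_le_of_surjective {k S T : Type*} [Field k] [CommRing S] [IsDomain S]
    [Algebra k S] [CommRing T] [IsDomain T] [Algebra k T] (f : S →ₐ[k] T)
    (hf : Function.Surjective f) (hinj : ¬ Function.Injective f) {s : ℕ}
    (hs : Algebra.trdeg k S ≤ s) :
    ∃ t : ℕ, Algebra.trdeg k T = t ∧ ((t + 1 : ℕ) : Cardinal) ≤ Algebra.trdeg k S := by
  obtain ⟨y, hy, hy0⟩ : ∃ y, f y = 0 ∧ y ≠ 0 := by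
    rw [injective_iff_map_eq_zero] at hinj
    push Not at hinj
    exact hinj
  obtain ⟨B, hB⟩ := exists_isTranscendenceBasis k T
  choose z hz using hf
  have hind : AlgebraicIndependent k (fun b : B => z b) := by
    refine AlgebraicIndependent.of_comp f ?_
    have : (f ∘ fun b : B => z b) = ((↑) : B → T) := by
      ext b
      simp [hz]
    rw [this]
    exact hB.1
  -- If `y` were algebraic over the lifted basis, it would divide some nonzero `c` in `k[z]`. Then
  -- `f c = 0` would be an algebraic relation on the basis of `T`.
  have htr : Transcendental (Algebra.adjoin k (Set.range fun b : B => z b)) y := by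
    intro halg
    obtain ⟨⟨c, hc⟩, hc0, u, hu⟩ :=
      halg.exists_nonzero_dvd (mem_nonZeroDivisors_of_ne_zero hy0)
    rw [Algebra.adjoin_range_eq_range_aeval] at hc
    obtain ⟨p, rfl⟩ := hc
    have hfp : f (MvPolynomial.aeval (fun b : B => z b) p) = 0 := by
      have : f (y * u) = 0 := by rw [map_mul, hy, zero_mul]
      rw [← hu] at this
      exact this
    have h2 : MvPolynomial.aeval (fun b : B => (b : T)) p = 0 := by
      rw [← AlgHom.comp_apply, MvPolynomial.comp_aeval] at hfp
      simpa [hz] using hfp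
    have hp : p = 0 := (algebraicIndependent_iff.mp hB.1) p h2
    exact hc0 (Subtype.ext (by simp [hp]))
  have hopt := (hind.option_iff_transcendental y).mpr htr
  have hle := hopt.lift_cardinalMk_le_trdeg
  have hcard := hB.lift_cardinalMk_eq_trdeg
  simp only [Cardinal.mk_option, Cardinal.lift_add, Cardinal.lift_one, Cardinal.lift_id] at hle hcard
  rw [hcard] at hle
  have hlt : Algebra.trdeg k T < Cardinal.aleph0 := by
    have h1 : Cardinal.lift (Algebra.trdeg k T) ≤ Cardinal.lift (Algebra.trdeg k S) :=
      le_trans (self_le_add_right _ _) hle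
    rw [← Cardinal.lift_lt_aleph0]
    refine lt_of_le_of_lt h1 ?_
    rw [Cardinal.lift_lt_aleph0]
    exact lt_of_le_of_lt hs (Cardinal.natCast_lt_aleph0)
  obtain ⟨t, ht⟩ := Cardinal.lt_aleph0.mp hlt
  refine ⟨t, ht, ?_⟩
  rw [ht] at hle
  simpa [← Cardinal.lift_le] using hle

section Generators

variable {k K V : Type*} [Field k] [Field K] [Algebra k K] [AddCommGroup V] [Module k V]
  [FiniteDimensional k V]

/-- If a linear map to a field extension kills a subspace, its values generate an extension
generated by as many elements as the codimension of the subspace. -/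
theorem exists_generators_of_le_ker (y : V →ₗ[k] K) (U : Submodule k V)
    (hU : U ≤ LinearMap.ker y) {r : ℕ} (hr : r ≤ Module.finrank k U) :
    ∃ S : Finset K, S.card ≤ Module.finrank k V - r ∧
      ∀ v, y v ∈ IntermediateField.adjoin k (S : Set K) := by
  classical
  have hdim : Module.finrank k (LinearMap.range y) ≤ Module.finrank k V - r := by
    have := LinearMap.finrank_range_add_finrank_ker y
    have := Submodule.finrank_mono hU
    omega
  let b := Module.finBasis k (LinearMap.range y)
  refine ⟨Finset.univ.image fun i => (b i : K), ?_, fun v => ?_⟩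
  · exact Finset.card_image_le.trans (by simpa using hdim)
  · have h := congrArg (fun x : LinearMap.range y => (x : K)) (b.sum_repr ⟨y v, v, rfl⟩)
    simp only [AddSubmonoidClass.coe_finsetSum, Submodule.coe_smul] at h
    rw [← h]
    refine sum_mem fun i _ => IntermediateField.smul_mem _ ?_
    exact IntermediateField.subset_adjoin _ _ (by simp)

/-- A square linear system `z = t C z + u` whose parameter `t` is transcendental over the field
of the entries of `C` has its solution in the field generated by `t` and `u`. -/
theorem mem_of_transcendental_system {ι : Type*} [Fintype ι] [DecidableEq ι]
    (L : IntermediateField k K) {t : K} (ht : Transcendental k t) (htL : t ∈ L)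
    (C : Matrix ι ι k) (z u : ι → K) (hu : ∀ i, u i ∈ L)
    (hz : ∀ i, z i = t * ∑ j, algebraMap k K (C i j) * z j + u i) (i : ι) : z i ∈ L := by
  let M : Matrix ι ι K := 1 - t • C.map (algebraMap k K)
  -- The determinant is the reversed characteristic polynomial of `C` evaluated at `t`. That
  -- polynomial has constant term `1`, so a transcendental `t` is not a root, and Cramer's rule
  -- applies over `L`.
  have hdet : M.det ≠ 0 := by
    have h1 : M.det = Polynomial.aeval t C.charpolyRev := by
      rw [Matrix.charpolyRev, AlgHom.map_det]
      congr 1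
      ext a b
      simp [M, Matrix.one_apply, apply_ite, mul_comm t]
    rw [h1]
    intro h0
    have := (transcendental_iff.mp ht) _ h0
    have h2 := Matrix.eval_charpolyRev (M := C)
    rw [this] at h2
    simp at h2
  have hMz : M.mulVec z = u := by
    ext a
    simp only [M, Matrix.sub_mulVec, Matrix.one_mulVec, Matrix.smul_mulVec, Pi.sub_apply,
      Pi.smul_apply, smul_eq_mul]
    conv_lhs => enter [1]; rw [hz a]
    simp [Matrix.mulVec, dotProduct]
  let ML : Matrix ι ι L := 1 - (⟨t, htL⟩ : L) • C.map (algebraMap k L)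
  have hML : ML.map (algebraMap L K) = M := by
    ext a b
    simp [ML, M, Matrix.one_apply, apply_ite (Subtype.val)]
  have hadj : M.adjugate = ML.adjugate.map (algebraMap L K) := by
    rw [← hML]
    exact ((algebraMap L K).map_adjugate ML).symm
  have hzi : M.det * z i = ∑ j, M.adjugate i j * u j := by
    have := congrArg (fun w => M.adjugate.mulVec w i) hMz
    simp only [Matrix.mulVec_mulVec, Matrix.adjugate_mul, Matrix.smul_mulVec,
      Matrix.one_mulVec] at this
    simpa [Matrix.mulVec, dotProduct] using this
  have hdetL : M.det ∈ L := by
    have : M.det = algebraMap L K ML.det := by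
      rw [← hML]
      exact ((algebraMap L K).map_det ML).symm
    rw [this]
    exact (ML.det).2
  have : z i = M.det⁻¹ * ∑ j, M.adjugate i j * u j := by
    rw [← hzi, inv_mul_cancel_left₀ hdet]
  rw [this]
  refine mul_mem (inv_mem hdetL) (sum_mem fun j _ => mul_mem ?_ (hu j))
  rw [hadj]
  exact (ML.adjugate i j).2

variable {W : Type*} [AddCommGroup W] [Module k W]

/-- If a linear map `y` to a field extension kills the member `B₁ - t B₂` of a pencil of linear maps
for a transcendental `t`, its values generate an extension generated by `t` and by as many further
elements as the codimension of the range of `B₁`. -/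
theorem exists_generators_of_transcendental (y : V →ₗ[k] K) (B₁ B₂ : W →ₗ[k] V) {t : K}
    (ht : Transcendental k t) (h : ∀ w, y (B₁ w) = t * y (B₂ w)) {r : ℕ}
    (hr : r ≤ Module.finrank k (LinearMap.range B₁)) :
    ∃ S : Finset K, S.card ≤ 1 + (Module.finrank k V - r) ∧
      ∀ v, y v ∈ IntermediateField.adjoin k (S : Set K) := by
  classical
  obtain ⟨Q, hQ⟩ := Submodule.exists_isCompl (LinearMap.range B₁)
  let b := Module.finBasis k (LinearMap.range B₁)
  let c := Module.finBasis k Q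
  let e := (b.prod c).map (Submodule.prodEquivOfIsCompl _ _ hQ)
  let S : Finset K := insert t (Finset.univ.image fun j => y (c j))
  have hdim := Submodule.finrank_add_eq_of_isCompl hQ
  have hS : ∀ x ∈ S, x ∈ IntermediateField.adjoin k (S : Set K) := fun x hx =>
    IntermediateField.subset_adjoin _ _ (by exact_mod_cast hx)
  have hcS : ∀ j, y (c j) ∈ IntermediateField.adjoin k (S : Set K) := fun j =>
    hS _ (Finset.mem_insert_of_mem (Finset.mem_image_of_mem _ (Finset.mem_univ _)))
  have htS := hS t (Finset.mem_insert_self _ _)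
  have he1 : ∀ i, e (Sum.inl i) = b i := fun i => by simp [e]
  have he2 : ∀ i, e (Sum.inr i) = c i := fun i => by simp [e]
  refine ⟨S, ?_, fun v => ?_⟩
  · refine (Finset.card_insert_le _ _).trans ?_
    have := Finset.card_image_le (s := Finset.univ) (f := fun j => y (c j))
    rw [Finset.card_univ, Fintype.card_fin] at this
    omega
  -- Choosing `w i` with `B₁ (w i) = b i` gives `y (b i) = t * y (B₂ (w i))`. Expanding `B₂ (w i)`
  -- in the basis `e` yields a square system for the `y (b i)`, whose inhomogeneous part involves
  -- only `t` and the `y (c j)`.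
  · have hbS : ∀ i, y (b i) ∈ IntermediateField.adjoin k (S : Set K) := by
      choose w hw using fun i => (b i).2
      refine mem_of_transcendental_system _ ht htS
        (Matrix.of fun i j => e.repr (B₂ (w i)) (Sum.inl j)) (fun i => y (b i))
        (fun i => t * ∑ j, algebraMap k K (e.repr (B₂ (w i)) (Sum.inr j)) * y (c j)) ?_ ?_
      · exact fun i => mul_mem htS (sum_mem fun j _ =>
          mul_mem (IntermediateField.algebraMap_mem _ _) (hcS j))
      · intro i
        have h1 : y (B₂ (w i)) = _ := congrArg y (e.sum_repr (B₂ (w i))).symm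
        rw [Fintype.sum_sum_type, map_add, map_sum, map_sum] at h1
        simp only [map_smul, he1, he2, Algebra.smul_def] at h1
        simp only [Matrix.of_apply]
        rw [← mul_add, ← h1, ← h, hw]
    rw [← e.sum_repr v, map_sum]
    refine sum_mem fun i _ => ?_
    rw [map_smul]
    refine IntermediateField.smul_mem _ ?_
    rcases i with i | i
    · rw [he1]; exact hbS i
    · rw [he2]; exact hcS i

/-- The generic point `y` of a variety of vectors at which the pencil spanned by `B₁` and `B₂`
is degenerate, all members of the pencil having rank at least `r`, generates a field of
transcendence degree at most `1 + (dim V - r)`. -/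
theorem exists_generators_of_pencil [IsAlgClosed k] (y : V →ₗ[k] K) (B₁ B₂ : W →ₗ[k] V)
    (hminor : ∀ w w', y (B₁ w) * y (B₂ w') = y (B₁ w') * y (B₂ w)) {r : ℕ}
    (hr : ∀ a b : k, ¬ (a = 0 ∧ b = 0) → r ≤ Module.finrank k (LinearMap.range (a • B₁ + b • B₂))) :
    ∃ S : Finset K, S.card ≤ 1 + (Module.finrank k V - r) ∧
      ∀ v, y v ∈ IntermediateField.adjoin k (S : Set K) := by
  -- This is the case `t = ∞`, where `y` kills the range of `B₂` itself.
  by_cases h2 : ∀ w, y (B₂ w) = 0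
  · obtain ⟨S, hS, hy⟩ := exists_generators_of_le_ker (r := r) y (LinearMap.range B₂)
      (by rintro _ ⟨w, rfl⟩; exact h2 w) (by
        have := hr 0 1 (by simp)
        rwa [zero_smul, one_smul, zero_add] at this)
    exact ⟨S, by omega, hy⟩
  push Not at h2
  obtain ⟨w₀, hw₀⟩ := h2
  have ht : ∀ w, y (B₁ w) = (y (B₁ w₀) / y (B₂ w₀)) * y (B₂ w) := by
    intro w
    have := hminor w w₀
    field_simp
    linear_combination this
  by_cases halg : IsAlgebraic k (y (B₁ w₀) / y (B₂ w₀))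
  · obtain ⟨c, hc⟩ : ∃ c : k, algebraMap k K c = y (B₁ w₀) / y (B₂ w₀) := by
      exact minpoly.mem_range_of_degree_eq_one k _
        (IsAlgClosed.degree_eq_one_of_irreducible k (minpoly.irreducible halg.isIntegral))
    obtain ⟨S, hS, hy⟩ := exists_generators_of_le_ker y
      (LinearMap.range ((1 : k) • B₁ + (-c) • B₂)) (by
        rintro _ ⟨w, rfl⟩
        simp [ht w, ← hc, Algebra.smul_def]) (hr 1 (-c) (by simp))
    exact ⟨S, by omega, hy⟩
  · exact exists_generators_of_transcendental y B₁ B₂ halg ht (by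
      have := hr 1 0 (by simp)
      rwa [zero_smul, one_smul, add_zero] at this)

/-- The transcendence degree of a domain whose fraction field is generated by a finite set. -/
theorem trdeg_le_card_of_adjoin_eq_top {A : Type*} [CommRing A] [IsDomain A] [Algebra k A]
    (S : Finset (FractionRing A))
    (hS : ∀ a : A, algebraMap A (FractionRing A) a ∈
      IntermediateField.adjoin k (S : Set (FractionRing A))) :
    Algebra.trdeg k A ≤ S.card := by
  have hfrac : ∀ x : FractionRing A, x ∈ IntermediateField.adjoin k (S : Set (FractionRing A)) := by
    intro x
    obtain ⟨a, b, -, rfl⟩ := IsFractionRing.div_surjective (A := A) x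
    exact div_mem (hS a) (hS b)
  have halg : Algebra.IsAlgebraic (Algebra.adjoin k (S : Set (FractionRing A)))
      (FractionRing A) := by
    refine ⟨fun x => ?_⟩
    obtain ⟨a, ha, b, hb, rfl⟩ := IntermediateField.mem_adjoin_iff_div.mp (hfrac x)
    exact (isAlgebraic_algebraMap (⟨a, ha⟩ : Algebra.adjoin k (S : Set (FractionRing A)))).mul
      (isAlgebraic_algebraMap (⟨b, hb⟩ : Algebra.adjoin k (S : Set (FractionRing A)))).inv
  have h1 := Algebra.IsAlgebraic.trdeg_le_cardinalMk k (S : Set (FractionRing A))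
  have h2 := trdeg_le_of_injective (IsScalarTower.toAlgHom k A (FractionRing A))
    (IsFractionRing.injective A (FractionRing A))
  refine (h2.trans h1).trans (by simp)

end Generators

end Kronecker

/-! ### Dimension of projective sets through their cones -/

namespace Kronecker

section Cone

variable {E : Type*} [AddCommGroup E] [Module ℂ E]

theorem isClosed_iff_isAlgebraicSet (Z : Set (ℙ ℂ E)) : IsClosed Z ↔ IsAlgebraicSet Z := by
  rw [← isOpen_compl_iff]
  change Zᶜᶜ ∈ {Z | IsAlgebraicSet Z} ↔ _
  rw [compl_compl]
  rfl

/-- The restriction of polynomials to the line spanned by a vector. -/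
noncomputable def lineHom (v : E) : MvPolynomial (Module.Dual ℂ E) ℂ →ₐ[ℂ] Polynomial ℂ :=
  MvPolynomial.aeval fun l : Module.Dual ℂ E => Polynomial.C (l v) * Polynomial.X

theorem lineHom_of_isHomogeneous (v : E) {P : MvPolynomial (Module.Dual ℂ E) ℂ} {d : ℕ}
    (hP : P.IsHomogeneous d) :
    lineHom v P = Polynomial.C (polyEval P v) * Polynomial.X ^ d := by
  rw [lineHom, polyEval, MvPolynomial.aeval_def, MvPolynomial.eval₂_eq, MvPolynomial.eval_eq,
    map_sum, Finset.sum_mul]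
  refine Finset.sum_congr rfl fun s hs => ?_
  have hdeg : ∑ i ∈ s.support, s i = d := by
    have := hP (MvPolynomial.mem_support_iff.mp hs)
    simpa [Finsupp.weight_apply, Finsupp.sum] using this
  rw [← hdeg, ← Finset.prod_pow_eq_pow_sum]
  simp only [mul_pow, Finset.prod_mul_distrib, map_mul, map_prod, map_pow,
    Polynomial.algebraMap_eq]
  ring

theorem lineHom_eq_zero_iff (v : E) {P : MvPolynomial (Module.Dual ℂ E) ℂ} {d : ℕ}
    (hP : P.IsHomogeneous d) : lineHom v P = 0 ↔ polyEval P v = 0 := by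
  simp [lineHom_of_isHomogeneous v hP]

/-- Grading by the line coordinate separates the homogeneous components; this is what makes an ideal
defined by restriction to lines homogeneous. -/
theorem coeff_lineHom (v : E) (P : MvPolynomial (Module.Dual ℂ E) ℂ) (i : ℕ) :
    (lineHom v P).coeff i = polyEval (MvPolynomial.homogeneousComponent i P) v := by
  conv_lhs => rw [← MvPolynomial.sum_homogeneousComponent P]
  rw [map_sum, Polynomial.finsetSum_coeff]
  simp only [lineHom_of_isHomogeneous v (MvPolynomial.homogeneousComponent_isHomogeneous _ P),
    Polynomial.coeff_C_mul_X_pow]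
  rw [Finset.sum_ite_eq]
  split_ifs with h
  · rfl
  · rw [MvPolynomial.homogeneousComponent_eq_zero]
    · simp [polyEval]
    · simpa using h

/-- The ideal of the polynomials which vanish on the cone over a subset of a projective space. -/
noncomputable def coneIdeal (Z : Set (ℙ ℂ E)) : Ideal (MvPolynomial (Module.Dual ℂ E) ℂ) :=
  ⨅ x ∈ Z, RingHom.ker (lineHom x.rep)

theorem mem_coneIdeal {Z : Set (ℙ ℂ E)} {P : MvPolynomial (Module.Dual ℂ E) ℂ} :
    P ∈ coneIdeal Z ↔ ∀ x ∈ Z, lineHom x.rep P = 0 := by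
  simp [coneIdeal, RingHom.mem_ker]

theorem mem_coneIdeal_of_isHomogeneous {Z : Set (ℙ ℂ E)}
    {P : MvPolynomial (Module.Dual ℂ E) ℂ} {d : ℕ} (hP : P.IsHomogeneous d) :
    P ∈ coneIdeal Z ↔ ∀ x ∈ Z, polyEval P x.rep = 0 := by
  rw [mem_coneIdeal]
  exact forall₂_congr fun x _ => lineHom_eq_zero_iff x.rep hP

attribute [local instance] MvPolynomial.gradedAlgebra

theorem coneIdeal_isHomogeneous (Z : Set (ℙ ℂ E)) :
    (coneIdeal Z).IsHomogeneous (MvPolynomial.homogeneousSubmodule (Module.Dual ℂ E) ℂ) := by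
  intro i P hP
  have hi : ((DirectSum.decompose (MvPolynomial.homogeneousSubmodule (Module.Dual ℂ E) ℂ) P i :
      MvPolynomial.homogeneousSubmodule (Module.Dual ℂ E) ℂ i) :
      MvPolynomial (Module.Dual ℂ E) ℂ) = MvPolynomial.homogeneousComponent i P :=
    MvPolynomial.decomposition.decompose'_apply P i
  rw [hi, mem_coneIdeal_of_isHomogeneous (MvPolynomial.homogeneousComponent_isHomogeneous i P)]
  intro x hx
  rw [← coeff_lineHom, mem_coneIdeal.mp hP x hx, Polynomial.coeff_zero]

/-- A homogeneous ideal need only be tested for primality on homogeneous elements, and these cut out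
closed sets. If `P * Q` vanishes on `Z`, irreducibility places `Z` in one of the two zero loci. -/
theorem coneIdeal_isPrime {Z : Set (ℙ ℂ E)} (hZ : IsIrreducible Z) : (coneIdeal Z).IsPrime := by
  obtain ⟨z, hz⟩ := hZ.nonempty
  refine (coneIdeal_isHomogeneous Z).isPrime_of_homogeneous_mem_or_mem ?_ ?_
  · rw [Ne, Ideal.eq_top_iff_one, mem_coneIdeal]
    intro h
    simpa using h z hz
  · rintro P Q ⟨a, ha⟩ ⟨b, hb⟩ hPQ
    have hP : P.IsHomogeneous a := ha
    have hQ : Q.IsHomogeneous b := hb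
    have hcl : ∀ {R : MvPolynomial (Module.Dual ℂ E) ℂ} {d : ℕ}, R.IsHomogeneous d →
        IsClosed (zeroLocus {R}) := fun {R d} hR =>
      (isClosed_iff_isAlgebraicSet _).mpr ⟨{R}, by rintro _ rfl; exact ⟨d, hR⟩, rfl⟩
    have hmem : ∀ {R : MvPolynomial (Module.Dual ℂ E) ℂ} {x : ℙ ℂ E},
        x ∈ zeroLocus {R} ↔ polyEval R x.rep = 0 := by simp [zeroLocus]
    rw [mem_coneIdeal_of_isHomogeneous hP, mem_coneIdeal_of_isHomogeneous hQ]
    have hsub : Z ⊆ zeroLocus {P} ∪ zeroLocus {Q} := by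
      intro x hx
      have := (mem_coneIdeal_of_isHomogeneous (hP.mul hQ)).mp hPQ x hx
      rw [polyEval, map_mul, mul_eq_zero] at this
      exact this.imp hmem.mpr hmem.mpr
    exact (isPreirreducible_iff_isClosed_union_isClosed.mp hZ.isPreirreducible _ _ (hcl hP) (hcl hQ)
      hsub).imp (fun h x hx => hmem.mp (h hx)) (fun h x hx => hmem.mp (h hx))

/-- The cone contains the line over a point `z`, and a linear form equal to `1` at `z.rep` restricts
to the coordinate `X` on it. This accounts for the `1` between the dimension of a set and that of
its cone. -/
theorem one_le_trdeg_coneIdeal {Z : Set (ℙ ℂ E)} (hZ : IsIrreducible Z) :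
    1 ≤ Algebra.trdeg ℂ (MvPolynomial (Module.Dual ℂ E) ℂ ⧸ coneIdeal Z) := by
  have := coneIdeal_isPrime hZ
  obtain ⟨z, hz⟩ := hZ.nonempty
  have : Algebra.Transcendental ℂ (MvPolynomial (Module.Dual ℂ E) ℂ ⧸ coneIdeal Z) := by
    obtain ⟨l, hl⟩ : ∃ l : Module.Dual ℂ E, l z.rep = 1 := by
      obtain ⟨l, hl⟩ : ∃ l : Module.Dual ℂ E, l z.rep ≠ 0 := by
        by_contra! h
        exact z.rep_nonzero ((Module.forall_dual_apply_eq_zero_iff ℂ _).mp h)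
      exact ⟨(l z.rep)⁻¹ • l, by simp [hl]⟩
    refine ⟨Ideal.Quotient.mk _ (MvPolynomial.X l), fun halg => ?_⟩
    have h2 := halg.algHom (Ideal.Quotient.liftₐ (coneIdeal Z) (lineHom z.rep)
      fun P hP => mem_coneIdeal.mp hP z hz)
    have h3 : Ideal.Quotient.liftₐ (coneIdeal Z) (lineHom z.rep)
        (fun P hP => mem_coneIdeal.mp hP z hz) (Ideal.Quotient.mk _ (MvPolynomial.X l)) =
        (Polynomial.X : Polynomial ℂ) := by
      change lineHom z.rep (MvPolynomial.X l) = _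
      simp [lineHom, hl]
    rw [h3] at h2
    exact Polynomial.transcendental_X ℂ h2
  rw [Cardinal.one_le_iff_pos]
  exact trdeg_pos ℂ _

/-- A subset of a projective space has dimension at most `d` if the cones over its irreducible
subsets have coordinate rings of transcendence degree at most `d + 1`. -/
theorem dimension_le_of_trdeg_le (Y : Set (ℙ ℂ E)) (d : ℕ)
    (h : ∀ Z ⊆ Y, IsIrreducible Z →
      Algebra.trdeg ℂ (MvPolynomial (Module.Dual ℂ E) ℂ ⧸ coneIdeal Z) ≤ (d + 1 : ℕ)) :
    dimension Y ≤ d := by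
  have hirr : ∀ s : TopologicalSpace.IrreducibleCloseds Y,
      IsIrreducible (Subtype.val '' (s : Set Y)) := fun s =>
    s.isIrreducible.image _ continuous_subtype_val.continuousOn
  have hsub : ∀ s : TopologicalSpace.IrreducibleCloseds Y, Subtype.val '' (s : Set Y) ⊆ Y := by
    rintro s _ ⟨x, -, rfl⟩
    exact x.2
  let N : TopologicalSpace.IrreducibleCloseds Y → ℕ := fun s => Cardinal.toNat
    (Algebra.trdeg ℂ (MvPolynomial (Module.Dual ℂ E) ℂ ⧸ coneIdeal (Subtype.val '' (s : Set Y))))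
  have hN : ∀ s : TopologicalSpace.IrreducibleCloseds Y, (N s : Cardinal) = Algebra.trdeg ℂ
      (MvPolynomial (Module.Dual ℂ E) ℂ ⧸ coneIdeal (Subtype.val '' (s : Set Y))) := fun s =>
    Cardinal.cast_toNat_of_lt_aleph0
      ((h _ (hsub s) (hirr s)).trans_lt Cardinal.natCast_lt_aleph0)
  have hmono : StrictMono N := by
    intro s t hst
    have hs := coneIdeal_isPrime (hirr s)
    have ht := coneIdeal_isPrime (hirr t)
    have hss : (s : Set Y) ⊂ t := hst
    have hle : coneIdeal (Subtype.val '' (t : Set Y)) ≤ coneIdeal (Subtype.val '' (s : Set Y)) :=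
      fun P hP => mem_coneIdeal.mpr fun x hx =>
        mem_coneIdeal.mp hP x (Set.image_mono hss.subset hx)
    -- The homogeneous equations of a closed set that cuts out `s` in `Y` lie in the ideal of `s`.
    -- If they also lay in the ideal of `t`, then `t` would be contained in `s`.
    have hnle : ¬ coneIdeal (Subtype.val '' (s : Set Y)) ≤
        coneIdeal (Subtype.val '' (t : Set Y)) := by
      intro hle'
      obtain ⟨x, hxt, hxs⟩ := Set.exists_of_ssubset hss
      obtain ⟨C, hC, hCs⟩ := isClosed_induced_iff.mp s.isClosed
      obtain ⟨S, hS, rfl⟩ := (isClosed_iff_isAlgebraicSet C).mp hC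
      rw [← hCs] at hxs
      apply hxs
      intro P hP
      obtain ⟨e, he⟩ := hS P hP
      refine (mem_coneIdeal_of_isHomogeneous he).mp (hle' ?_) x ⟨x, hxt, rfl⟩
      rw [mem_coneIdeal_of_isHomogeneous he]
      rintro _ ⟨y, hy, rfl⟩
      rw [← hCs] at hy
      exact hy P hP
    obtain ⟨u, hu, hu'⟩ := trdeg_add_one_le_of_surjective (Ideal.Quotient.factorₐ ℂ hle)
      (Ideal.Quotient.factor_surjective hle) (fun hinj => hnle fun P hP => by
        rw [← Ideal.Quotient.eq_zero_iff_mem] at hP ⊢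
        apply hinj
        rw [map_zero]
        exact hP) (h _ (hsub t) (hirr t))
    rw [← hN] at hu hu'
    have h1 : N s = u := by exact_mod_cast hu
    have h2 : u + 1 ≤ N t := by exact_mod_cast hu'
    omega
  refine iSup_le fun p => ?_
  have h1 := (p.map N hmono).head_add_length_le_nat
  have h2 : 1 ≤ N p.head := by
    have := one_le_trdeg_coneIdeal (hirr p.head)
    rw [← hN] at this
    exact_mod_cast this
  have h3 : N p.last ≤ d + 1 := by
    have := h _ (hsub p.last) (hirr p.last)
    rw [← hN] at this
    exact_mod_cast this
  rw [LTSeries.head_map, LTSeries.last_map, LTSeries.map_length] at h1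
  have : p.length ≤ d := by omega
  exact_mod_cast this

end Cone

end Kronecker

/-! ### The generic point of the degeneracy locus -/

namespace Kronecker

section GenericPoint

variable {E : Type*} [AddCommGroup E] [Module ℂ E]

/-- The linear forms as functions on the cone over a subset of a projective space. -/
noncomputable def coneForm (Z : Set (ℙ ℂ E)) :
    Module.Dual ℂ E →ₗ[ℂ] MvPolynomial (Module.Dual ℂ E) ℂ ⧸ coneIdeal Z where
  toFun l := Ideal.Quotient.mk _ (MvPolynomial.X l)
  map_add' l l' := by
    rw [← map_add, Ideal.Quotient.eq, mem_coneIdeal]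
    intro x _
    simp only [lineHom, map_sub, map_add, MvPolynomial.aeval_X, LinearMap.add_apply]
    ring
  map_smul' c l := by
    change _ = Ideal.Quotient.mk (coneIdeal Z) (c • MvPolynomial.X l)
    rw [Ideal.Quotient.eq, mem_coneIdeal]
    intro x _
    simp [lineHom, Polynomial.smul_eq_C_mul, mul_assoc]

theorem mem_intermediateField_of_coneForm_mem {Z : Set (ℙ ℂ E)} {K : Type*} [Field K]
    [Algebra ℂ K] (f : (MvPolynomial (Module.Dual ℂ E) ℂ ⧸ coneIdeal Z) →ₐ[ℂ] K)
    (L : IntermediateField ℂ K) (h : ∀ l, f (coneForm Z l) ∈ L)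
    (a : MvPolynomial (Module.Dual ℂ E) ℂ ⧸ coneIdeal Z) : f a ∈ L := by
  obtain ⟨P, rfl⟩ := Ideal.Quotient.mk_surjective a
  induction P using MvPolynomial.induction_on with
  | C c =>
    have : f (Ideal.Quotient.mk (coneIdeal Z) (MvPolynomial.C c)) = algebraMap ℂ K c :=
      f.commutes c
    rw [this]
    exact L.algebraMap_mem c
  | add P Q hP hQ =>
    rw [map_add, map_add]
    exact add_mem hP hQ
  | mul_X P l hP =>
    rw [map_mul, map_mul]
    exact mul_mem hP (h l)

end GenericPoint

section Degeneracy

variable {W I V : Type*} [AddCommGroup W] [Module ℂ W] [AddCommGroup I] [Module ℂ I]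
  [AddCommGroup V] [Module ℂ V]

/-- The map `(φ ⊗ id) ∘ a : W → V` obtained from `a : W → I ⊗ V` by contraction with a linear form
on `I`. -/
noncomputable def contract (a : W →ₗ[ℂ] I ⊗[ℂ] V) : Module.Dual ℂ I →ₗ[ℂ] W →ₗ[ℂ] V where
  toFun φ := (TensorProduct.lid ℂ V).toLinearMap ∘ₗ LinearMap.rTensor V φ ∘ₗ a
  map_add' φ ψ := by
    ext w
    simp [LinearMap.rTensor_add]
  map_smul' c φ := by
    ext w
    simp [LinearMap.rTensor_smul]

theorem contract_apply (a : W →ₗ[ℂ] I ⊗[ℂ] V) (φ : Module.Dual ℂ I) (w : W) :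
    contract a φ w = TensorProduct.lid ℂ V (LinearMap.rTensor V φ (a w)) := rfl

theorem fibreMap_apply (a : W →ₗ[ℂ] I ⊗[ℂ] V) (ξ : Module.Dual ℂ V) (φ : Module.Dual ℂ I) (w : W) :
    fibreMap a ξ φ w = ξ (contract a φ w) := by
  have : TensorProduct.dualDistrib ℂ I V (φ ⊗ₜ[ℂ] ξ) =
      ξ ∘ₗ (TensorProduct.lid ℂ V).toLinearMap ∘ₗ LinearMap.rTensor V φ := by
    ext i v
    simp
  exact congrArg (fun f => f (a w)) this

/-- Two multiples of a single linear form have vanishing minors. In this polynomial form the rank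
condition passes to the generic point. -/
theorem minor_eq_zero_of_mem_degeneracyLocus [FiniteDimensional ℂ I]
    {A : ℙ ℂ (W →ₗ[ℂ] I ⊗[ℂ] V)} {x : ℙ ℂ (Module.Dual ℂ V)} (hx : x ∈ degeneracyLocus A)
    (φ ψ : Module.Dual ℂ I) (w w' : W) :
    x.rep (contract A.rep φ w) * x.rep (contract A.rep ψ w') =
      x.rep (contract A.rep φ w') * x.rep (contract A.rep ψ w) := by
  have hx' : Module.finrank ℂ (LinearMap.range (fibreMap A.rep x.rep)) ≤ 1 := hx
  obtain ⟨⟨u, hu⟩, h⟩ := finrank_le_one_iff.mp hx'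
  obtain ⟨c, hc⟩ := h ⟨_, φ, rfl⟩
  obtain ⟨d, hd⟩ := h ⟨_, ψ, rfl⟩
  have hc' : c • u = fibreMap A.rep x.rep φ := congrArg Subtype.val hc
  have hd' : d • u = fibreMap A.rep x.rep ψ := congrArg Subtype.val hd
  simp only [← fibreMap_apply, ← hc', ← hd', LinearMap.smul_apply, smul_eq_mul]
  ring

theorem dimension_degeneracyLocus_le [FiniteDimensional ℂ I] [FiniteDimensional ℂ V]
    (hI : Module.finrank ℂ I = 2) (A : ℙ ℂ (W →ₗ[ℂ] I ⊗[ℂ] V)) {r : ℕ}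
    (hr : ∀ φ : Module.Dual ℂ I, φ ≠ 0 →
      r ≤ Module.finrank ℂ (LinearMap.range (contract A.rep φ))) :
    dimension (degeneracyLocus A) ≤ (Module.finrank ℂ V - r : ℕ) := by
  refine dimension_le_of_trdeg_le _ _ fun Z hZ hirr => ?_
  have := coneIdeal_isPrime hirr
  let R := MvPolynomial (Module.Dual ℂ (Module.Dual ℂ V)) ℂ ⧸ coneIdeal Z
  let ι : R →ₐ[ℂ] FractionRing R := IsScalarTower.toAlgHom ℂ R (FractionRing R)
  let y : V →ₗ[ℂ] FractionRing R := ι.toLinearMap ∘ₗ coneForm Z ∘ₗ Module.Dual.eval ℂ V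
  let b := Module.finBasisOfFinrankEq ℂ (Module.Dual ℂ I)
    ((Subspace.dual_finrank_eq (K := ℂ) (V := I)).trans hI)
  have hminor : ∀ w w', y (contract A.rep (b 0) w) * y (contract A.rep (b 1) w') =
      y (contract A.rep (b 0) w') * y (contract A.rep (b 1) w) := by
    intro w w'
    simp only [y, LinearMap.comp_apply, AlgHom.toLinearMap_apply]
    rw [← map_mul ι, ← map_mul ι]
    refine congrArg ι (Ideal.Quotient.eq.mpr (mem_coneIdeal.mpr ?_))
    intro x hx
    have := minor_eq_zero_of_mem_degeneracyLocus (hZ hx) (b 0) (b 1) w w'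
    simp only [lineHom, map_sub, map_mul, MvPolynomial.aeval_X, Module.Dual.eval_apply]
    -- The minor is quadratic in the point, so its restriction to the line is its value times `X ^
    -- 2`.
    have h2 := congrArg Polynomial.C this
    rw [map_mul, map_mul] at h2
    linear_combination (Polynomial.X ^ 2) * h2
  have hrank : ∀ α β : ℂ, ¬ (α = 0 ∧ β = 0) → r ≤ Module.finrank ℂ
      (LinearMap.range (α • contract A.rep (b 0) + β • contract A.rep (b 1))) := by
    intro α β hαβ
    rw [← map_smul (contract A.rep), ← map_smul (contract A.rep), ← map_add]
    refine hr _ fun h0 => hαβ ?_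
    have := Fintype.linearIndependent_iff.mp b.linearIndependent ![α, β]
      (by simpa [Fin.sum_univ_two] using h0)
    exact ⟨this 0, this 1⟩
  obtain ⟨S, hS, hy⟩ := exists_generators_of_pencil y _ _ hminor hrank
  refine (trdeg_le_card_of_adjoin_eq_top (k := ℂ) S
    (mem_intermediateField_of_coneForm_mem ι _ fun l => ?_)).trans ?_
  · obtain ⟨v, rfl⟩ := (Module.evalEquiv ℂ V).surjective l
    exact hy v
  · exact_mod_cast hS.trans (by omega)

theorem le_codimension_degeneracyLocus [FiniteDimensional ℂ I] [FiniteDimensional ℂ V]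
    (hI : Module.finrank ℂ I = 2) (A : ℙ ℂ (W →ₗ[ℂ] I ⊗[ℂ] V)) {r : ℕ}
    (hr : ∀ φ : Module.Dual ℂ I, φ ≠ 0 →
      r + 1 ≤ Module.finrank ℂ (LinearMap.range (contract A.rep φ))) :
    (r : ℕ∞) ≤ codimension (degeneracyLocus A) := by
  have hdim := dimension_degeneracyLocus_le hI A hr
  -- This makes the truncated subtraction `finrank V - (r + 1)` a true one; it needs some nonzero
  -- `φ`.
  have hle : r + 1 ≤ Module.finrank ℂ V := by
    have : Nontrivial (Module.Dual ℂ I) := by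
      rw [← Module.finrank_pos_iff (R := ℂ), Subspace.dual_finrank_eq, hI]
      norm_num
    obtain ⟨φ, hφ⟩ := exists_ne (0 : Module.Dual ℂ I)
    exact (hr φ hφ).trans (Submodule.finrank_le _)
  unfold codimension
  generalize dimension (degeneracyLocus A) = e at hdim
  induction e using WithBot.recBotCoe with
  | bot => exact le_top
  | coe d =>
    have hd : d ≤ ((Module.finrank ℂ V - (r + 1) : ℕ) : ℕ∞) :=
      WithBot.coe_le_coe.mp hdim
    lift d to ℕ using ne_top_of_le_ne_top (ENat.natCast_ne_top _) hd
    have hd' : d ≤ Module.finrank ℂ V - (r + 1) := by exact_mod_cast hd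
    change (r : ℕ∞) ≤ ((Module.finrank ℂ (Module.Dual ℂ V) - 1 : ℕ) : ℕ∞) - (d : ℕ∞)
    rw [Subspace.dual_finrank_eq]
    have : r ≤ Module.finrank ℂ V - 1 - d := by omega
    exact_mod_cast this

end Degeneracy

end Kronecker

/-! ### Limits and one-parameter subgroups -/

namespace Kronecker

section Limits

variable {E : Type*} [AddCommGroup E] [Module ℂ E]

theorem eval_aeval_polynomial {σ : Type*} (f : σ → Polynomial ℂ) (s : ℂ) (P : MvPolynomial σ ℂ) :
    (MvPolynomial.aeval f P).eval s = MvPolynomial.eval (fun l => (f l).eval s) P := by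
  induction P using MvPolynomial.induction_on with
  | C c => simp
  | add P Q hP hQ => simp [hP, hQ]
  | mul_X P l hP => simp [hP]

theorem polyEval_smul {P : MvPolynomial (Module.Dual ℂ E) ℂ} {d : ℕ} (hP : P.IsHomogeneous d)
    (c : ℂ) (v : E) : polyEval P (c • v) = c ^ d * polyEval P v := by
  have h : (lineHom v P).eval c = polyEval P (c • v) := by
    rw [lineHom, eval_aeval_polynomial]
    refine congrArg (fun f => MvPolynomial.eval f P) (funext fun l => ?_)
    simp only [Polynomial.eval_mul, Polynomial.eval_C, Polynomial.eval_X, map_smul, smul_eq_mul]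
    ring
  rw [← h, lineHom_of_isHomogeneous v hP]
  simp [mul_comm (c ^ d)]

theorem polyEval_rep_mk_eq_zero_iff {P : MvPolynomial (Module.Dual ℂ E) ℂ} {d : ℕ}
    (hP : P.IsHomogeneous d) (v : E) (hv : v ≠ 0) :
    polyEval P (Projectivization.mk ℂ v hv).rep = 0 ↔ polyEval P v = 0 := by
  obtain ⟨c, hc⟩ := Projectivization.exists_smul_eq_mk_rep ℂ v hv
  rw [← hc, Units.smul_def, polyEval_smul hP]
  simp

/-- A polynomial which is constant on a curve `s ↦ s ^ e v + s ^ f w` off `s = 0` has the same value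
at `s = 0`. -/
theorem polyEval_eq_of_forall_ne_zero (P : MvPolynomial (Module.Dual ℂ E) ℂ) (v w : E) (e f : ℕ)
    (c : ℂ) (h : ∀ s : ℂˣ, polyEval P ((s : ℂ) ^ e • v + (s : ℂ) ^ f • w) = c) :
    polyEval P ((0 : ℂ) ^ e • v + (0 : ℂ) ^ f • w) = c := by
  let p : Polynomial ℂ := MvPolynomial.aeval (fun l : Module.Dual ℂ E =>
    Polynomial.C (l v) * Polynomial.X ^ e + Polynomial.C (l w) * Polynomial.X ^ f) P
  have hp : ∀ s : ℂ, p.eval s = polyEval P (s ^ e • v + s ^ f • w) := by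
    intro s
    simp only [p]
    rw [eval_aeval_polynomial]
    refine congrArg (fun f => MvPolynomial.eval f P) (funext fun l => ?_)
    simp only [Polynomial.eval_add, Polynomial.eval_mul, Polynomial.eval_C, Polynomial.eval_pow,
      Polynomial.eval_X, map_add, map_smul, smul_eq_mul]
    ring
  have hpc : p = Polynomial.C c := by
    refine Polynomial.eq_of_infinite_eval_eq _ _ ((Set.finite_singleton (0 : ℂ)).infinite_compl.mono
      fun s hs => ?_)
    have hs' : s ≠ 0 := hs
    simpa [hp] using h (Units.mk0 s hs')
  rw [← hp, hpc, Polynomial.eval_C]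

end Limits

section SpecialLinear

variable {M : Type*} [AddCommGroup M] [Module ℂ M] [FiniteDimensional ℂ M]

theorem exists_specialLinearGroup_of_idempotent (π : M →ₗ[ℂ] M) (hπ : IsIdempotentElem π)
    (c d : ℂ) (h : c ^ Module.finrank ℂ (LinearMap.range π) *
      d ^ Module.finrank ℂ (LinearMap.ker π) = 1) :
    ∃ g : SpecialLinearGroup ℂ M, (g.toLinearEquiv : M →ₗ[ℂ] M) = c • π + d • (1 - π) := by
  let e := Submodule.prodEquivOfIsCompl _ _ (LinearMap.IsIdempotentElem.isCompl hπ)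
  have hconj : c • π + d • (1 - π) = e.toLinearMap ∘ₗ
      (LinearMap.prodMap (c • LinearMap.id) (d • LinearMap.id)) ∘ₗ e.symm.toLinearMap := by
    ext x
    obtain ⟨⟨y, z⟩, rfl⟩ := e.surjective x
    obtain ⟨y, y, rfl⟩ := y
    obtain ⟨z, hz⟩ := z
    have h1 : π (π y) = π y := congrArg (fun f => f y) hπ
    have h2 : π z = 0 := hz
    have he : ∀ p, e p = (p.1 : M) + p.2 := fun p => by simp [e]
    simp only [LinearMap.comp_apply, LinearEquiv.coe_coe, LinearEquiv.symm_apply_apply]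
    simp [he, h1, h2]
  have hdet : LinearMap.det (c • π + d • (1 - π)) = 1 := by
    rw [hconj, LinearMap.det_conj, LinearMap.det_prodMap, LinearMap.det_smul, LinearMap.det_smul,
      LinearMap.det_id, LinearMap.det_id, mul_one, mul_one, h]
  have hcoe : ((LinearMap.equivOfDetNeZero (c • π + d • (1 - π))
      (by rw [hdet]; exact one_ne_zero) : M ≃ₗ[ℂ] M) : M →ₗ[ℂ] M) = c • π + d • (1 - π) :=
    LinearEquiv.coe_ofIsUnitDet _
  refine ⟨⟨LinearMap.equivOfDetNeZero _ (by rw [hdet]; exact one_ne_zero), ?_⟩, hcoe⟩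
  rw [← Units.val_inj, LinearEquiv.coe_det, hcoe, hdet, Units.val_one]

end SpecialLinear

section OneParameter

variable {W I V : Type*} [AddCommGroup W] [Module ℂ W] [AddCommGroup I] [Module ℂ I]
  [AddCommGroup V] [Module ℂ V]

theorem slRep_apply (g : SpecialLinearGroup ℂ I) (h : SpecialLinearGroup ℂ W)
    (a : W →ₗ[ℂ] I ⊗[ℂ] V) :
    slRep W I V (g, h⁻¹) a = (LinearMap.rTensor V (g.toLinearEquiv : I →ₗ[ℂ] I)) ∘ₗ a ∘ₗ
      (h.toLinearEquiv : W →ₗ[ℂ] W) := by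
  change (LinearMap.rTensor V (g.toLinearEquiv : I →ₗ[ℂ] I)) ∘ₗ a ∘ₗ
      ((h⁻¹⁻¹).toLinearEquiv : W →ₗ[ℂ] W) = _
  rw [inv_inv]

/-- The one-parameter family of group elements attached to a linear form `φ` on `I` for which
`w = dim ker (φ ⊗ id) ∘ a` is at least half of `dim W`. It acts on `a` with only two weights, both
of them nonnegative. -/
theorem exists_oneParameter_weights [FiniteDimensional ℂ W] [FiniteDimensional ℂ I]
    (hI : Module.finrank ℂ I = 2) (a : W →ₗ[ℂ] I ⊗[ℂ] V)
    {φ : Module.Dual ℂ I} (hφ : φ ≠ 0) {e N : ℕ} (hN : Module.finrank ℂ W = N)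
    (he : 2 * Module.finrank ℂ (LinearMap.ker (contract a φ)) = N + e) :
    ∃ (a₀ a₁ : W →ₗ[ℂ] I ⊗[ℂ] V) (g : ℂˣ → SpecialLinearGroup ℂ I × SpecialLinearGroup ℂ W)
      (u : I), a = a₀ + a₁ ∧ u ≠ 0 ∧ ∀ t : ℂˣ,
        slRep W I V (g t) a₀ = (t : ℂ) ^ e • a₀ ∧
        slRep W I V (g t) a₁ = (t : ℂ) ^ (2 * N + e) • a₁ ∧
        (g t).1 u = (t : ℂ) ^ N • u := by
  obtain ⟨v, hv⟩ : ∃ v, φ v = 1 := by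
    obtain ⟨v, hv⟩ : ∃ v, φ v ≠ 0 := by
      by_contra! h
      exact hφ (LinearMap.ext h)
    exact ⟨(φ v)⁻¹ • v, by simp [hv]⟩
  let π : I →ₗ[ℂ] I := φ.smulRight v
  have hπ : IsIdempotentElem π := by
    ext x
    simp [π, hv]
  have hπrange : Module.finrank ℂ (LinearMap.range π) = 1 := by
    have hrange : LinearMap.range π = Submodule.span ℂ {v} := by
      ext x
      rw [Submodule.mem_span_singleton]
      constructor
      · rintro ⟨y, rfl⟩
        exact ⟨φ y, rfl⟩
      · rintro ⟨c, rfl⟩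
        exact ⟨c • v, by simp [π, hv]⟩
    rw [hrange]
    refine finrank_span_singleton ?_
    rintro rfl
    simp at hv
  have hπker : Module.finrank ℂ (LinearMap.ker π) = 1 := by
    have := LinearMap.finrank_range_add_finrank_ker π
    omega
  obtain ⟨u, hu, hu0⟩ : ∃ u, π u = 0 ∧ u ≠ 0 := by
    refine (Submodule.ne_bot_iff (LinearMap.ker π)).mp fun hbot => ?_
    rw [hbot, finrank_bot] at hπker
    exact zero_ne_one hπker
  obtain ⟨ρ, hρ, hρrange⟩ : ∃ ρ : W →ₗ[ℂ] W, IsIdempotentElem ρ ∧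
      LinearMap.range ρ = LinearMap.ker (contract a φ) := by
    obtain ⟨Q, hQ⟩ := Submodule.exists_isCompl (LinearMap.ker (contract a φ))
    exact ⟨Submodule.projection _ _ hQ, Submodule.isIdempotentElem_projection hQ, Submodule.range_projection hQ⟩
  set w := Module.finrank ℂ (LinearMap.ker (contract a φ)) with hw
  have hρker : Module.finrank ℂ (LinearMap.ker ρ) + w = N := by
    have := LinearMap.finrank_range_add_finrank_ker ρ
    rw [hρrange] at this
    omega
  -- The weights are `-N, N` on `I` and `-2(N - w), 2w` on `W`. Each set has weighted sum zero, so
  -- both determinants are `1`.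
  have hg : ∀ t : ℂˣ, ∃ g : SpecialLinearGroup ℂ I, (g.toLinearEquiv : I →ₗ[ℂ] I) =
      ((t : ℂ) ^ N)⁻¹ • π + (t : ℂ) ^ N • (1 - π) := fun t =>
    exists_specialLinearGroup_of_idempotent π hπ _ _ (by
      rw [hπrange, hπker]
      simp)
  have hh : ∀ t : ℂˣ, ∃ h : SpecialLinearGroup ℂ W, (h.toLinearEquiv : W →ₗ[ℂ] W) =
      ((t : ℂ) ^ (2 * (N - w)))⁻¹ • ρ + (t : ℂ) ^ (2 * w) • (1 - ρ) := fun t =>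
    exists_specialLinearGroup_of_idempotent ρ hρ _ _ (by
      rw [hρrange, ← hw, ← hρker, Nat.add_sub_cancel, inv_pow, ← pow_mul, ← pow_mul]
      rw [inv_mul_eq_one₀ (by simp)]
      ring)
  choose g hg using hg
  choose h hh using hh
  -- This block would have the weight `-N - 2(N - w)`, the only one that can be negative; it
  -- vanishes because `ρ` maps into the kernel of the contraction.
  have hzero : LinearMap.rTensor V π ∘ₗ a ∘ₗ ρ = 0 := by
    ext x
    have hx : contract a φ (ρ x) = 0 := by
      have : ρ x ∈ LinearMap.ker (contract a φ) := hρrange ▸ ⟨x, rfl⟩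
      exact this
    have key : ∀ z : I ⊗[ℂ] V, LinearMap.rTensor V π z =
        v ⊗ₜ TensorProduct.lid ℂ V (LinearMap.rTensor V φ z) := by
      intro z
      induction z with
      | zero => simp
      | add x y hx hy => simp [hx, hy, TensorProduct.tmul_add]
      | tmul x y => simp [π, TensorProduct.smul_tmul]
    rw [contract_apply] at hx
    simp [key, hx]
  -- The two mixed blocks `p` and `q` share the weight `2w - N = e`, and the block `a₁` has weight
  -- `N + 2w = 2N + e`.
  let a₁ := LinearMap.rTensor V (1 - π) ∘ₗ a ∘ₗ (1 - ρ)
  let p := LinearMap.rTensor V (1 - π) ∘ₗ a ∘ₗ ρ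
  let q := LinearMap.rTensor V π ∘ₗ a ∘ₗ (1 - ρ)
  have hact : ∀ (t : ℂˣ) (b : W →ₗ[ℂ] I ⊗[ℂ] V) (α : I →ₗ[ℂ] I) (β : W →ₗ[ℂ] W) (c d : ℂ),
      ((g t).toLinearEquiv : I →ₗ[ℂ] I) ∘ₗ α = c • α →
      β ∘ₗ ((h t).toLinearEquiv : W →ₗ[ℂ] W) = d • β →
      slRep W I V (g t, (h t)⁻¹) (LinearMap.rTensor V α ∘ₗ b ∘ₗ β) =
        (c * d) • (LinearMap.rTensor V α ∘ₗ b ∘ₗ β) := by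
    intro t b α β c d hα hβ
    rw [slRep_apply]
    calc _ = (LinearMap.rTensor V (((g t).toLinearEquiv : I →ₗ[ℂ] I) ∘ₗ α)) ∘ₗ b ∘ₗ
          (β ∘ₗ ((h t).toLinearEquiv : W →ₗ[ℂ] W)) := by
            rw [LinearMap.rTensor_comp]
            rfl
      _ = _ := by
        rw [hα, hβ, LinearMap.rTensor_smul]
        ext x
        simp [mul_smul]
  have hπ' : ∀ x, π (π x) = π x := fun x => congrArg (fun f => f x) hπ
  have hρ' : ∀ x, ρ (ρ x) = ρ x := fun x => congrArg (fun f => f x) hρ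
  have hgπ : ∀ t, ((g t).toLinearEquiv : I →ₗ[ℂ] I) ∘ₗ π = ((t : ℂ) ^ N)⁻¹ • π := by
    intro t
    ext x
    simp [hg, hπ']
  have hgπ' : ∀ t, ((g t).toLinearEquiv : I →ₗ[ℂ] I) ∘ₗ (1 - π) = (t : ℂ) ^ N • (1 - π) := by
    intro t
    ext x
    simp [hg, hπ']
  have hhρ : ∀ t, ρ ∘ₗ ((h t).toLinearEquiv : W →ₗ[ℂ] W) =
      ((t : ℂ) ^ (2 * (N - w)))⁻¹ • ρ := by
    intro t
    ext x
    simp [hh, hρ']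
  have hhρ' : ∀ t, (1 - ρ) ∘ₗ ((h t).toLinearEquiv : W →ₗ[ℂ] W) =
      (t : ℂ) ^ (2 * w) • (1 - ρ) := by
    intro t
    ext x
    simp [hh, hρ']
  refine ⟨p + q, a₁, fun t => (g t, (h t)⁻¹), u, ?_, hu0, fun t => ⟨?_, ?_, ?_⟩⟩
  · have : a = LinearMap.rTensor V (π + (1 - π)) ∘ₗ a ∘ₗ (ρ + (1 - ρ)) := by
      ext x
      simp [Module.End.one_eq_id]
    rw [LinearMap.rTensor_add, LinearMap.add_comp, LinearMap.comp_add _ _ a, LinearMap.comp_add,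
      LinearMap.comp_add, hzero] at this
    refine this.trans ?_
    simp only [p, q, a₁]
    abel
  · have ht := t.ne_zero
    rw [map_add, hact t a _ _ _ _ (hgπ' t) (hhρ t), hact t a _ _ _ _ (hgπ t) (hhρ' t), smul_add]
    congr 2
    · have hpow : (t : ℂ) ^ N = (t : ℂ) ^ (2 * (N - w)) * (t : ℂ) ^ e := by
        rw [← pow_add]
        congr 1
        omega
      rw [hpow, mul_comm, inv_mul_cancel_left₀ (pow_ne_zero _ ht)]
    · rw [he, pow_add, inv_mul_cancel_left₀ (pow_ne_zero _ ht)]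
  · rw [hact t a _ _ _ _ (hgπ' t) (hhρ' t), ← pow_add]
    congr 2
    omega
  · have := congrArg (fun f => f u) (hg t)
    simpa [hu] using this

end OneParameter

end Kronecker

/-! ### Rank bounds from semistability and stability -/

namespace Kronecker

section Action

variable {G E : Type*} [Group G] [AddCommGroup E] [Module ℂ E]

theorem projAct_mul (ρ : Representation ℂ G E) (g h : G) (x : ℙ ℂ E) :
    projAct ρ (g * h) x = projAct ρ g (projAct ρ h x) := by
  induction x with
  | h v hv =>
    simp only [projAct, Projectivization.map_mk]
    simp

theorem projAct_one (ρ : Representation ℂ G E) (x : ℙ ℂ E) : projAct ρ 1 x = x := by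
  induction x with
  | h v hv =>
    simp only [projAct, Projectivization.map_mk]
    simp

theorem finite_stabilizer_of_mem_projOrbit (ρ : Representation ℂ G E) {x y : ℙ ℂ E}
    (hy : y ∈ projOrbit ρ x) (hx : {g : G | projAct ρ g x = x}.Finite) :
    {g : G | projAct ρ g y = y}.Finite := by
  obtain ⟨k, rfl⟩ := hy
  refine Set.Finite.of_finite_image (f := fun g => k⁻¹ * g * k) (hx.subset ?_) ?_
  · rintro _ ⟨g, hg, rfl⟩
    have hg' : projAct ρ g (projAct ρ k x) = projAct ρ k x := hg
    change projAct ρ (k⁻¹ * g * k) x = x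
    rw [projAct_mul, projAct_mul, hg', ← projAct_mul, inv_mul_cancel, projAct_one]
  · intro g _ g' _ h
    simpa using h

/-- A homogeneous polynomial vanishing on the orbit vanishes along the curve `v + t ^ f • w` for `t
≠ 0`, hence also at `t = 0`. -/
theorem mk_mem_closure_projOrbit (ρ : Representation ℂ G E) (v w : E) (hvw : v + w ≠ 0)
    (hv : v ≠ 0) {f : ℕ} (hf : f ≠ 0) (g : ℂˣ → G)
    (hg : ∀ t, ρ (g t) (v + w) = v + (t : ℂ) ^ f • w) :
    Projectivization.mk ℂ v hv ∈ closure (projOrbit ρ (Projectivization.mk ℂ (v + w) hvw)) := by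
  have hcl := (isClosed_iff_isAlgebraicSet _).mp
    (isClosed_closure (s := projOrbit ρ (Projectivization.mk ℂ (v + w) hvw)))
  obtain ⟨S, hS, hSeq⟩ := hcl
  have hsub := subset_closure (s := projOrbit ρ (Projectivization.mk ℂ (v + w) hvw))
  rw [hSeq] at hsub ⊢
  intro P hP
  obtain ⟨d, hd⟩ := hS P hP
  rw [polyEval_rep_mk_eq_zero_iff hd]
  have h := polyEval_eq_of_forall_ne_zero P v w 0 f 0 fun s => by
    have := hsub ⟨g s, rfl⟩ P hP
    simp only [projAct, Projectivization.map_mk] at this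
    rw [polyEval_rep_mk_eq_zero_iff hd, hg] at this
    simpa using this
  simpa [zero_pow hf] using h

end Action

section Stability

variable {W I V : Type*} [AddCommGroup W] [Module ℂ W] [FiniteDimensional ℂ W]
  [AddCommGroup I] [Module ℂ I] [FiniteDimensional ℂ I] [AddCommGroup V] [Module ℂ V]

/-- The easy half of the Hilbert-Mumford criterion for semistability. -/
theorem finrank_le_of_isSemistable (hI : Module.finrank ℂ I = 2)
    {A : ℙ ℂ (W →ₗ[ℂ] I ⊗[ℂ] V)} (hA : IsSemistable (slRep W I V) A)
    {φ : Module.Dual ℂ I} (hφ : φ ≠ 0) :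
    Module.finrank ℂ W ≤ 2 * Module.finrank ℂ (LinearMap.range (contract A.rep φ)) := by
  by_contra! hlt
  have hrk := LinearMap.finrank_range_add_finrank_ker (contract A.rep φ)
  obtain ⟨e, he⟩ : ∃ e, 2 * Module.finrank ℂ (LinearMap.ker (contract A.rep φ)) =
      Module.finrank ℂ W + e := ⟨_, (Nat.add_sub_of_le (by omega)).symm⟩
  obtain ⟨a₀, a₁, g, u, ha, -, hg⟩ := exists_oneParameter_weights hI A.rep hφ rfl he
  obtain ⟨d, P, hd, hP, hinv, hne⟩ := hA
  have h := polyEval_eq_of_forall_ne_zero P a₀ a₁ e (2 * Module.finrank ℂ W + e)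
    (polyEval P A.rep) fun s => by
      rw [← (hg s).1, ← (hg s).2.1, ← map_add, ← ha, hinv]
  -- Here `e > 0`, so the limit is the zero vector, at which a form of positive degree vanishes.
  rw [zero_pow (by omega), zero_pow (by omega), zero_smul, zero_smul, add_zero,
    ← zero_smul ℂ A.rep, polyEval_smul hP, zero_pow hd.ne', zero_mul] at h
  exact hne h.symm

/-- The easy half of the Hilbert-Mumford criterion for stability. -/
theorem finrank_lt_of_isStable (hI : Module.finrank ℂ I = 2) (hW : 0 < Module.finrank ℂ W)
    {A : ℙ ℂ (W →ₗ[ℂ] I ⊗[ℂ] V)} (hA : IsStable (slRep W I V) A)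
    {φ : Module.Dual ℂ I} (hφ : φ ≠ 0) :
    Module.finrank ℂ W < 2 * Module.finrank ℂ (LinearMap.range (contract A.rep φ)) := by
  obtain ⟨hss, hclosed, hfin⟩ := hA
  refine lt_of_le_of_ne (finrank_le_of_isSemistable hI hss hφ) fun heq => ?_
  have hrk := LinearMap.finrank_range_add_finrank_ker (contract A.rep φ)
  have he : 2 * Module.finrank ℂ (LinearMap.ker (contract A.rep φ)) =
      Module.finrank ℂ W + 0 := by omega
  obtain ⟨a₀, a₁, g, u, ha, hu, hg⟩ := exists_oneParameter_weights hI A.rep hφ rfl he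
  simp only [pow_zero, one_smul, add_zero] at hg
  have hlim : ∀ s, slRep W I V (g s) (a₀ + a₁) =
      a₀ + (s : ℂ) ^ (2 * Module.finrank ℂ W) • a₁ := fun s => by
    rw [map_add, (hg s).1, (hg s).2.1]
  obtain ⟨d, P, hd, hP, hinv, hne⟩ := hss
  -- With `e = 0` the limit is `a₀`, and the invariant `P` keeps its value there. So `a₀` is nonzero
  -- and semistable, and closedness puts it in the orbit of `A`.
  have hP₀ : polyEval P a₀ ≠ 0 := by
    have h := polyEval_eq_of_forall_ne_zero P a₀ a₁ 0 (2 * Module.finrank ℂ W)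
      (polyEval P A.rep) fun s => by
        rw [pow_zero, one_smul, ← hlim, hinv, ← ha]
    rw [pow_zero, one_smul, zero_pow (by omega), zero_smul, add_zero] at h
    rwa [h]
  have ha₀ : a₀ ≠ 0 := by
    rintro rfl
    rw [← zero_smul ℂ A.rep, polyEval_smul hP, zero_pow hd.ne', zero_mul] at hP₀
    exact hP₀ rfl
  have hA : A = Projectivization.mk ℂ (a₀ + a₁) (ha ▸ A.rep_nonzero) := by
    conv_lhs => rw [← A.mk_rep]
    congr 1
  have hfin₀ := finite_stabilizer_of_mem_projOrbit _ (hclosed (Projectivization.mk ℂ a₀ ha₀)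
    ⟨d, P, hd, hP, hinv, fun h => hP₀ ((polyEval_rep_mk_eq_zero_iff hP a₀ ha₀).mp h)⟩
    (by
      rw [hA]
      exact mk_mem_closure_projOrbit _ a₀ a₁ _ ha₀ (by omega) g hlim)) hfin
  -- Every `g t` fixes `a₀` and scales `u` by a power of `t`. As `ℂ` contains all roots, every
  -- nonzero multiple of `u` is reached, so the stabilizer is infinite.
  have himage := hfin₀.image fun k => k.1 u
  have hinf : ((fun s : ℂ => s • u) '' {0}ᶜ).Infinite :=
    (Set.finite_singleton (0 : ℂ)).infinite_compl.image (smul_left_injective ℂ hu).injOn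
  refine hinf (himage.subset ?_)
  rintro _ ⟨s, hs, rfl⟩
  obtain ⟨t, ht⟩ := IsAlgClosed.exists_pow_nat_eq s hW
  have ht0 : t ≠ 0 := by
    rintro rfl
    rw [zero_pow hW.ne'] at ht
    exact hs ht.symm
  refine ⟨g (Units.mk0 t ht0), ?_, ?_⟩
  · change projAct _ _ _ = _
    simp only [projAct, Projectivization.map_mk, (hg _).1]
  · simp only [(hg _).2.2, Units.val_mk0, ht]

end Stability

end Kronecker

/-! ### The codimension bounds -/

theorem corollary2p4 {W I V : Type*}
    [AddCommGroup W] [Module ℂ W] [FiniteDimensional ℂ W]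
    [AddCommGroup I] [Module ℂ I] [FiniteDimensional ℂ I]
    [AddCommGroup V] [Module ℂ V] [FiniteDimensional ℂ V]
    (m n : ℕ) (hW : Module.finrank ℂ W = m + 2) (hI : Module.finrank ℂ I = 2)
    (hV : Module.finrank ℂ V = n + 1) (hmn : m + 2 ≤ 2 * (n + 1))
    (A : ℙ ℂ (W →ₗ[ℂ] I ⊗[ℂ] V)) :
    (Odd m → Kronecker.IsSemistable (Kronecker.slRep W I V) A →
      (((m + 1) / 2 : ℕ) : ℕ∞) ≤ Kronecker.codimension (Kronecker.degeneracyLocus A)) ∧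
    (Even m → Kronecker.IsSemistable (Kronecker.slRep W I V) A →
      ((m / 2 : ℕ) : ℕ∞) ≤ Kronecker.codimension (Kronecker.degeneracyLocus A)) ∧
    (Even m → Kronecker.IsStable (Kronecker.slRep W I V) A →
      ((m / 2 : ℕ) : ℕ∞) < Kronecker.codimension (Kronecker.degeneracyLocus A)) := by
  refine ⟨?_, ?_, ?_⟩
  · rintro ⟨k, rfl⟩ hA
    refine Kronecker.le_codimension_degeneracyLocus hI A fun φ hφ => ?_
    have := Kronecker.finrank_le_of_isSemistable hI hA hφ
    omega
  · rintro ⟨k, rfl⟩ hA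
    refine Kronecker.le_codimension_degeneracyLocus hI A fun φ hφ => ?_
    have := Kronecker.finrank_le_of_isSemistable hI hA hφ
    omega
  · rintro ⟨k, rfl⟩ hA
    -- With `m = 2k`, stability gives `2k + 2 < 2 * rank`, so the rank is at least `k + 2` and the
    -- codimension at least `k + 1`.
    refine lt_of_lt_of_le ?_
      (Kronecker.le_codimension_degeneracyLocus (r := (k + k) / 2 + 1) hI A fun φ hφ => ?_)
    · exact_mod_cast Nat.lt_succ_self _
    · have := Kronecker.finrank_lt_of_isStable hI (by omega) hA hφ
      omega
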